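/- \textbf{Setting.} Let $\mathcal B$ be a partition of $\{1,\dots,d_z\}$ into non-empty blocks; for $z\in\mathbb R^{d_z}$ and $B\in\mathcal B$ let $z_B\in\mathbb R^{|B|}$ be the subvector with coordinates in $B$, and for $\mathcal Z\subseteq\mathbb R^{d_z}$ let $\mathcal Z_B=\{z_B\mid z\in\mathcal Z\}$ and $\mathrm{CPE}_{\mathcal B}(\mathcal Z)=\{z\in\mathbb R^{d_z}\mid z_B\in\mathcal Z_B\ \text{for all } B\in\mathcal B\}=\prod_{B\in\mathcal B}\mathcal Z_B$. A map on an arbitrary subset $A$ of a Euclidean space is called $C^2$ if it extends to a $C^2$ map on an open set containing $A$; a $C^2$-diffeomorphism between two sets is a $C^2$ bijection whose inverse is $C^2$. Let $\sigma:\mathbb R^{d_x}\to\mathbb R^{d_x}$ be injective (invertible onto its range). \textbf{Assumptions.} (1) $\mathcal Z^{\mathrm{test}}\subseteq\mathbb R^{d_z}$ is open and $f:\mathcal Z^{\mathrm{test}}\to\mathbb R^{d_x}$ is a $C^2$-diffeomorphism onto its image. $\mathbb P$ is a probability measure on $\mathbb R^{d_z}$ whose support $\mathcal Z^{\mathrm{train}}$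 is contained in $\mathcal Z^{\mathrm{test}}$ and is regularly closed, i.e. equal to the closure of its interior. (2) $\hat f:\mathbb R^{d_z}\to\mathbb R^{d_x}$ is a $C^2$-diffeomorphism onto its image and $\hat g:\mathbb R^{d_x}\to\mathbb R^{d_z}$ is continuous. Put $\hat{\mathcal Z}^{\mathrm{train}}=\hat g(f(\mathcal Z^{\mathrm{train}}))$. (3) $f$ and $\hat f$ are additive: there are $C^2$ functions $f^{(B)}:\mathcal Z^{\mathrm{test}}_B\to\mathbb R^{d_x}$ and $\hat f^{(B)}:\mathbb R^{|B|}\to\mathbb R^{d_x}$, $B\in\mathcal B$, with $f(z)=\sigma\big(\sum_{B}f^{(B)}(z_B)\big)$ for all $z\in\mathcal Z^{\mathrm{test}}$ and $\hat f(z)=\sigma\big(\sum_{B}\hat f^{(B)}(z_B)\big)$ for all $z\in\mathbb R^{d_z}$. (4) (Sufficient nonlinearity.) For every $z\in\mathcal Z^{\mathrm{train}}$ the vectors $D_if^{(B)}(z_B)$ ($B\in\mathcal B$, $i\in B$) and $D^2_{i,i'}f^{(B)}(z_B)$ ($B\in\mathcal B$, $i,i'\in B$, $i'\le i$), taken together,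 are linearly independent in $\mathbb R^{d_x}$. (5) Any two points of $\mathcal Z^{\mathrm{train}}$ are joined by a continuously differentiable path $[0,1]\to\mathcal Z^{\mathrm{train}}$. (6) For every $B\in\mathcal B$, $f^{(B)}$ is injective on $\mathcal Z^{\mathrm{train}}_B$ and $\hat f^{(B)}$ is injective on $\hat{\mathcal Z}^{\mathrm{train}}_B$. (7) $\mathbb E_{z\sim\mathbb P}\,\|f(z)-\hat f(\hat g(f(z)))\|^2=0$. \textbf{Conclusion.} The decoder $\hat f$ is $\mathcal B$-disentangled with respect to $f$, i.e. $f(\mathcal Z^{\mathrm{train}})=\hat f(\hat{\mathcal Z}^{\mathrm{train}})$, the map $v=f^{-1}\circ\hat f$ is a $C^2$-diffeomorphism from $\hat{\mathcal Z}^{\mathrm{train}}$ to $\mathcal Z^{\mathrm{train}}$, and there are a permutation $\pi$ of $\{1,\dots,d_z\}$ with $\pi(B)\in\mathcal B$ for all $B\in\mathcal B$ and functions $\bar v_{\pi(B)}:\hat{\mathcal Z}^{\mathrm{train}}_B\to\mathcal Z^{\mathrm{train}}_{\pi(B)}$, $B\in\mathcal B$, such that $v_{\pi(B)}(z)=\bar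 v_{\pi(B)}(z_B)$ for all $z\in\hat{\mathcal Z}^{\mathrm{train}}$. For all such $\pi$ and $\bar v_{\pi(B)}$, $$\sigma\Big(\sum_{B\in\mathcal B}\hat f^{(B)}(z_B)\Big)=\sigma\Big(\sum_{B\in\mathcal B}f^{(\pi(B))}\big(\bar v_{\pi(B)}(z_B)\big)\Big)\qquad\text{for all } z\in\mathrm{CPE}_{\mathcal B}(\hat{\mathcal Z}^{\mathrm{train}}).$$ Furthermore, if $\mathrm{CPE}_{\mathcal B}(\mathcal Z^{\mathrm{train}})\subseteq\mathcal Z^{\mathrm{test}}$, then $\hat f(\mathrm{CPE}_{\mathcal B}(\hat{\mathcal Z}^{\mathrm{train}}))\subseteq f(\mathcal Z^{\mathrm{test}})$. -/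

import Mathlib

open MeasureTheory

noncomputable section

/-- The vector space `ℝ^ι` with its Euclidean norm. -/
abbrev Vec (ι : Type) [Fintype ι] : Type := EuclideanSpace ℝ ι

/-- A partition of the index set `{1, …, d}` into non-empty blocks. -/
abbrev BlockPartition (d : ℕ) : Type := Finpartition (Finset.univ : Finset (Fin d))

/-- The subvector `z_B` of `z` formed by the coordinates in `B`. -/
def subvec {d : ℕ} (B : Finset (Fin d)) (z : Vec (Fin d)) : Vec B :=
  WithLp.toLp 2 (fun i : B => z i)

/-- The projection `Z_B = {z_B | z ∈ Z}`. -/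
def projSet {d : ℕ} (B : Finset (Fin d)) (Z : Set (Vec (Fin d))) : Set (Vec B) :=
  subvec B '' Z

/-- The Cartesian-product extension `∏_{B ∈ 𝓑} Z_B`, seen as a subset of `ℝ^d`. -/
def cartesianExt {d : ℕ} (𝓑 : BlockPartition d) (Z : Set (Vec (Fin d))) : Set (Vec (Fin d)) :=
  {z | ∀ B ∈ 𝓑.parts, subvec B z ∈ projSet B Z}

/-- `f` is `C²` on an arbitrary set `A`: it agrees on `A` with a function that is `C²` on an open
set containing `A`. -/
def IsC2On {E F : Type} [NormedAddCommGroup E] [NormedSpace ℝ E] [NormedAddCommGroup F]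
    [NormedSpace ℝ F] (f : E → F) (A : Set E) : Prop :=
  ∃ (U : Set E) (g : E → F), IsOpen U ∧ A ⊆ U ∧ ContDiffOn ℝ 2 g U ∧ Set.EqOn f g A

/-- `f` restricts to a `C²`-diffeomorphism from `A` to `A'`: a bijection that is `C²` and has a
`C²` inverse. -/
def IsC2Diffeo {E F : Type} [NormedAddCommGroup E] [NormedSpace ℝ E] [NormedAddCommGroup F]
    [NormedSpace ℝ F] (f : E → F) (A : Set E) (A' : Set F) : Prop :=
  Set.BijOn f A A' ∧ IsC2On f A ∧ ∃ g : F → E, Set.InvOn g f A A' ∧ IsC2On g A'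

/-- `f` restricts to a `C²`-diffeomorphism from `A` onto its image. -/
def IsC2DiffeoOntoImage {E F : Type} [NormedAddCommGroup E] [NormedSpace ℝ E]
    [NormedAddCommGroup F] [NormedSpace ℝ F] (f : E → F) (A : Set E) : Prop :=
  IsC2Diffeo f A (f '' A)

/-- A set is regularly closed when it is the closure of its interior. -/
def IsRegularlyClosed {E : Type} [TopologicalSpace E] (Z : Set E) : Prop :=
  Z = closure (interior Z)

/-- Any two points of `Z` are joined by a continuously differentiable path inside `Z`. -/
def IsC1PathConnected {E : Type} [NormedAddCommGroup E] [NormedSpace ℝ E] (Z : Set E) : Prop :=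
  ∀ x ∈ Z, ∀ y ∈ Z, ∃ φ : ℝ → E, ContDiffOn ℝ 1 φ (Set.Icc 0 1) ∧
    Set.MapsTo φ (Set.Icc 0 1) Z ∧ φ 0 = x ∧ φ 1 = y

/-- `f : Z → ℝ^n` is `(σ, 𝓑)`-additive with block-specific functions `fB B : Z_B → ℝ^n`:
`f z = σ (∑_B fB B z_B)` for all `z ∈ Z`. The block-specific functions are `C²`. -/
structure IsAdditiveWith {d n : ℕ} (σ : Vec (Fin n) → Vec (Fin n)) (𝓑 : BlockPartition d)
    (Z : Set (Vec (Fin d))) (f : Vec (Fin d) → Vec (Fin n))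
    (fB : ∀ B : 𝓑.parts, Vec B.1 → Vec (Fin n)) : Prop where
  eq_sum : ∀ z ∈ Z, f z = σ (∑ B : 𝓑.parts, fB B (subvec B.1 z))
  c2_block : ∀ B : 𝓑.parts, IsC2On (fB B) (projSet B.1 Z)

/-- The partial derivative `D_i h`. -/
def partialD {ι : Type} [Fintype ι] [DecidableEq ι] {n : ℕ} (i : ι) (h : Vec ι → Vec (Fin n)) :
    Vec ι → Vec (Fin n) :=
  fun w => fderiv ℝ h w (EuclideanSpace.single i 1)

/-- Index set of the columns of the matrix `W(z)`: for every block `B`, the indices `i ∈ B` and the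
pairs `(i, i') ∈ B × B` with `i' ≤ i`. -/
abbrev ColIndex {d : ℕ} (𝓑 : BlockPartition d) : Type :=
  Σ B : 𝓑.parts, B.1 ⊕ {p : B.1 × B.1 // p.2 ≤ p.1}

/-- The columns `D_i f^(B)(z_B)` and `D²_{i,i'} f^(B)(z_B)` of the matrix `W(z)`. -/
def colW {d n : ℕ} (𝓑 : BlockPartition d) (fB : ∀ B : 𝓑.parts, Vec B.1 → Vec (Fin n))
    (z : Vec (Fin d)) : ColIndex 𝓑 → Vec (Fin n)
  | ⟨B, Sum.inl i⟩ => partialD i (fB B) (subvec B.1 z)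
  | ⟨B, Sum.inr p⟩ => partialD p.1.1 (partialD p.1.2 (fB B)) (subvec B.1 z)

/-- Sufficient nonlinearity on `Z`: the columns of `W(z)` are linearly independent for all
`z ∈ Z`. -/
def IsSufficientlyNonlinear {d n : ℕ} (𝓑 : BlockPartition d)
    (fB : ∀ B : 𝓑.parts, Vec B.1 → Vec (Fin n)) (Z : Set (Vec (Fin d))) : Prop :=
  ∀ z ∈ Z, LinearIndependent ℝ (colW 𝓑 fB z)

/-- The data-generating process: an open set `Ztest`, a ground-truth decoder `f` that is a
`C²`-diffeomorphism from `Ztest` onto its image, and a law `P` of the latent vector whose support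
`Ztrain` is regularly closed and contained in `Ztest`. -/
structure IsDataGenerating {d n : ℕ} (Ztest Ztrain : Set (Vec (Fin d)))
    (f : Vec (Fin d) → Vec (Fin n)) (P : Measure (Vec (Fin d))) : Prop where
  isOpen_test : IsOpen Ztest
  diffeo : IsC2DiffeoOntoImage f Ztest
  prob : IsProbabilityMeasure P
  support_eq : P.support = Ztrain
  train_subset_test : Ztrain ⊆ Ztest
  regularlyClosed : IsRegularlyClosed Ztrain

/-- The latent codes `ĝ(f(Ztrain))` that the encoder outputs on the training distribution. -/
def latentCodes {d n : ℕ} (ghat : Vec (Fin n) → Vec (Fin d)) (f : Vec (Fin d) → Vec (Fin n))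
    (Ztrain : Set (Vec (Fin d))) : Set (Vec (Fin d)) :=
  ghat '' (f '' Ztrain)

/-- The reconstruction problem is solved exactly: `𝔼 ‖x - f̂(ĝ(x))‖² = 0` for `x = f(z)`,
`z ∼ P`. -/
def SolvesReconstruction {d n : ℕ} (P : Measure (Vec (Fin d))) (f fhat : Vec (Fin d) → Vec (Fin n))
    (ghat : Vec (Fin n) → Vec (Fin d)) : Prop :=
  ∫⁻ z, ‖f z - fhat (ghat (f z))‖ₑ ^ 2 ∂P = 0

/-- The map `v = f⁻¹ ∘ f̂`, where `f⁻¹` is the inverse of `f` restricted to `Ztest`. -/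
def vMap {d n : ℕ} (Ztest : Set (Vec (Fin d))) (f fhat : Vec (Fin d) → Vec (Fin n)) :
    Vec (Fin d) → Vec (Fin d) :=
  fun z => Function.invFunOn f Ztest (fhat z)

/-- The permutation `π` respects the partition `𝓑`: it maps blocks to blocks. -/
def RespectsPartition {d : ℕ} (𝓑 : BlockPartition d) (π : Equiv.Perm (Fin d)) : Prop :=
  ∀ B ∈ 𝓑.parts, B.map π.toEmbedding ∈ 𝓑.parts

/-- The block `π(B)`. -/
def permBlock {d : ℕ} {𝓑 : BlockPartition d} {π : Equiv.Perm (Fin d)}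
    (hπ : RespectsPartition 𝓑 π) (B : 𝓑.parts) : 𝓑.parts :=
  ⟨B.1.map π.toEmbedding, hπ B.1 B.2⟩

/-- The learned decoder `f̂` is `𝓑`-disentangled w.r.t. `f`, as witnessed by the `𝓑`-respecting
permutation `π` and the functions `vbar B`, which stand for `v̄_{π(B)} : Ẑtrain_B → Ztrain_{π(B)}`:
`v` is a diffeomorphism from `Ẑtrain` to `Ztrain` and `v_{π(B)}(z) = v̄_{π(B)}(z_B)` there. -/
structure IsDisentangledVia {d n : ℕ} (𝓑 : BlockPartition d) (Ztest Ztrain Zhat : Set (Vec (Fin d)))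
    (f fhat : Vec (Fin d) → Vec (Fin n)) (π : Equiv.Perm (Fin d)) (hπ : RespectsPartition 𝓑 π)
    (vbar : ∀ B : 𝓑.parts, Vec B.1 → Vec (permBlock hπ B).1) : Prop where
  image_eq : f '' Ztrain = fhat '' Zhat
  diffeo : IsC2Diffeo (vMap Ztest f fhat) Zhat Ztrain
  mapsTo : ∀ B : 𝓑.parts,
    Set.MapsTo (vbar B) (projSet B.1 Zhat) (projSet (permBlock hπ B).1 Ztrain)
  block_eq : ∀ B : 𝓑.parts, ∀ z ∈ Zhat,
    subvec (permBlock hπ B).1 (vMap Ztest f fhat z) = vbar B (subvec B.1 z)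

end

/-!
Exact reconstruction makes the encoded latents `u = ĝ ∘ f` a `C²` change of coordinates on the
training support with inverse `v = f⁻¹ ∘ f̂`, and cancelling `σ` gives the identity
`∑_B f̂^(B)(x_B) = ∑_B f^(B)(v_B(x))`.

The mixed derivative of the left-hand side in two coordinates `i`, `i'` of different blocks is zero.
On the right-hand side it is a combination of the first and second derivatives of the `f^(B)`, which
are linearly independent. Hence all the coefficients vanish, that is
`D_i v_j D_i' v_j' + D_i v_j' D_i' v_j = 0` whenever `j`, `j'` lie in the same block
(`IsC2Reparam.jacobianMatrix_mul_add_mul`). So each block of rows of the invertible matrix `Dv` is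
nonzero in the columns of one block only. By continuity that block is the same on the whole
connected support, and a nonzero term of the Leibniz formula for `det Dv` provides the permutation
(`exists_perm_of_blockwise`). These identities hold in the interior of the support first, where the
inverse function theorem makes `u` open, and extend to its closure because `u` and `v` are `C²` in a
neighbourhood.

To pass from derivatives to values, the difference `f̂^(B)(x_B) - f^(π(B))(v_{π(B)}(x))` is shown to
have zero derivative along `C¹` paths, so it is a constant `c_B`, and the `c_B` sum to zero
(`IsC2Reparam.block_sub_block_eq`). Injectivity of `f^(π(B))` then makes `v_{π(B)}` a function of
`x_B`. Since the constants belong to single blocks, blocks coming from different points of the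
support can be combined, which gives the identity on the Cartesian-product extension. For an
arbitrary disentangling `π` the sparsity of `Dv` comes from differentiating `v_{π(B)}(x) = v̄(x_B)`
(`IsC2Reparam.jacobianMatrix_eq_zero`).
-/

open Filter Topology

/-! ### Block structure of invertible matrices -/

/-- If the columns of two different blocks satisfy the symmetrised product relation on each block of
rows, then the nonzero entries of a given block of rows all lie in columns of a single block. -/
lemma column_block_eq_of_mul_add_mul_eq_zero {ι K : Type*} {β : ι → K} {m : ι → ι → ℝ}
    (hm : ∀ i i' j j', β i ≠ β i' → β j = β j' → m j i * m j' i' + m j' i * m j i' = 0)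
    {i i' j j' : ι} (hj : β j = β j') (h : m j i ≠ 0) (h' : m j' i' ≠ 0) : β i = β i' := by
  by_contra hne
  have h1 : m j i' = 0 := by
    have := hm i i' j j hne rfl
    have : m j i * m j i' = 0 := by linarith
    exact (mul_eq_zero.1 this).resolve_left h
  have h2 := hm i i' j j' hne hj
  rw [h1, mul_zero, add_zero] at h2
  exact (mul_ne_zero h h') h2

/-- A permutation that maps equally labelled indices to equally labelled indices reflects equality
of labels, since it induces a surjective self-map of the finite set of labels. -/
lemma label_eq_of_perm_label_eq {ι K : Type*} [Finite K] {β : ι → K}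
    (hβ : Function.Surjective β) {τ : Equiv.Perm ι}
    (hτ : ∀ j j', β j = β j' → β (τ j) = β (τ j')) {j j' : ι} (h : β (τ j) = β (τ j')) :
    β j = β j' := by
  let κ : K → K := fun k => β (τ (Function.surjInv hβ k))
  have hκ : ∀ j, κ (β j) = β (τ j) := fun j => hτ _ _ (Function.surjInv_eq hβ _)
  have hsurj : Function.Surjective κ := fun k => by
    obtain ⟨j, rfl⟩ := hβ k
    exact ⟨β (τ.symm j), by rw [hκ, Equiv.apply_symm_apply]⟩
  have hinj := Finite.injective_iff_surjective.2 hsurj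
  exact hinj (by rw [hκ, hκ, h])

/-- A nonzero determinant has a nonzero term in its Leibniz expansion. -/
lemma exists_perm_forall_ne_zero {ι : Type*} [Fintype ι] [DecidableEq ι] {m : Matrix ι ι ℝ}
    (hm : m.det ≠ 0) : ∃ π : Equiv.Perm ι, ∀ i, m (π i) i ≠ 0 := by
  rw [Matrix.det_apply] at hm
  obtain ⟨π, -, hπ⟩ := Finset.exists_ne_zero_of_sum_ne_zero hm
  refine ⟨π, fun i hi => hπ ?_⟩
  have : ∏ i, m (π i) i = 0 := Finset.prod_eq_zero (Finset.mem_univ i) hi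
  simp [this]

/-- Along a connected set of invertible matrices with the symmetrised product relation, the block
of columns that carries a given row does not change, so one permutation describes the block
structure of all the matrices. -/
lemma exists_perm_of_blockwise {X ι K : Type*} [TopologicalSpace X] [Fintype ι] [DecidableEq ι]
    [Finite K] {β : ι → K} (hβ : Function.Surjective β) {Z : Set X} (hZ : IsPreconnected Z)
    (hne : Z.Nonempty) {m : X → Matrix ι ι ℝ} (hcont : ∀ j i, ContinuousOn (fun z => m z j i) Z)
    (hdet : ∀ z ∈ Z, (m z).det ≠ 0)
    (hm : ∀ z ∈ Z, ∀ i i' j j', β i ≠ β i' → β j = β j' →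
      m z j i * m z j' i' + m z j' i * m z j i' = 0) :
    ∃ π : Equiv.Perm ι, (∀ i i', β (π i) = β (π i') ↔ β i = β i') ∧
      ∀ z ∈ Z, ∀ i j, β i ≠ β (π.symm j) → m z j i = 0 := by
  classical
  have hrow : ∀ z ∈ Z, ∀ j, ∃ i, m z j i ≠ 0 := by
    intro z hz j
    obtain ⟨π, hπ⟩ := exists_perm_forall_ne_zero (hdet z hz)
    exact ⟨π.symm j, by simpa using hπ (π.symm j)⟩
  have hconst : ∀ j, ∀ z ∈ Z, ∀ z' ∈ Z, ∀ i i', m z j i ≠ 0 → m z' j i' ≠ 0 → β i = β i' := by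
    intro j z hz z' hz' i i' hi hi'
    let κ : X → K := fun z => if h : ∃ i, m z j i ≠ 0 then β h.choose else β i
    have hκ : ∀ z ∈ Z, ∀ i, m z j i ≠ 0 → κ z = β i := by
      intro z hz i hi
      have h : ∃ i, m z j i ≠ 0 := ⟨i, hi⟩
      simp only [κ, dif_pos h]
      exact column_block_eq_of_mul_add_mul_eq_zero (hm z hz) rfl h.choose_spec hi
    let _ : TopologicalSpace K := ⊥
    have : DiscreteTopology K := ⟨rfl⟩
    have hκc : ContinuousOn κ Z := by
      intro z hz
      obtain ⟨i, hi⟩ := hrow z hz j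
      have hev : ∀ᶠ y in 𝓝[Z] z, m y j i ≠ 0 :=
        (hcont j i z hz).eventually (isOpen_ne.mem_nhds hi)
      refine (continuousWithinAt_const (b := β i)).congr_of_eventuallyEq ?_ (hκ z hz i hi)
      filter_upwards [hev, self_mem_nhdsWithin] with y hy hyZ using hκ y hyZ i hy
    rw [← hκ z hz i hi, ← hκ z' hz' i' hi', hZ.constant hκc hz hz']
  obtain ⟨z₀, hz₀⟩ := hne
  obtain ⟨π, hπ⟩ := exists_perm_forall_ne_zero (hdet z₀ hz₀)
  have hsymm : ∀ j j', β j = β j' → β (π.symm j) = β (π.symm j') := fun j j' h =>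
    column_block_eq_of_mul_add_mul_eq_zero (hm z₀ hz₀) h
      (by simpa using hπ (π.symm j)) (by simpa using hπ (π.symm j'))
  refine ⟨π, fun i i' => ⟨fun h => ?_, fun h => ?_⟩, fun z hz i j hij => ?_⟩
  · simpa using hsymm _ _ h
  · exact label_eq_of_perm_label_eq hβ hsymm (by simpa using h)
  · by_contra h
    exact hij (hconst j z hz z₀ hz₀ _ _ h (by simpa using hπ (π.symm j)))

/-! ### Second derivatives of compositions and of block sums -/

section Calculus

variable {E F G : Type*} [NormedAddCommGroup E] [NormedSpace ℝ E] [NormedAddCommGroup F]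
  [NormedSpace ℝ F] [NormedAddCommGroup G] [NormedSpace ℝ G]

lemma ContDiffAt.eventually_differentiableAt {f : E → F} {x : E} (hf : ContDiffAt ℝ 2 f x) :
    ∀ᶠ y in 𝓝 x, DifferentiableAt ℝ f y := by
  filter_upwards [hf.eventually (by simp)] with y hy using hy.differentiableAt (by simp)

lemma ContDiffAt.hasFDerivAt_fderiv {f : E → F} {x : E} (hf : ContDiffAt ℝ 2 f x) :
    HasFDerivAt (fderiv ℝ f) (fderiv ℝ (fderiv ℝ f) x) x :=
  ((hf.fderiv_right (m := 1) (by norm_num)).differentiableAt (by simp)).hasFDerivAt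

/-- The second-order chain rule. -/
lemma fderiv_fderiv_comp {f : F → G} {v : E → F} {x : E} (hf : ContDiffAt ℝ 2 f (v x))
    (hv : ContDiffAt ℝ 2 v x) (a b : E) :
    fderiv ℝ (fderiv ℝ (f ∘ v)) x b a =
      fderiv ℝ (fderiv ℝ f) (v x) (fderiv ℝ v x b) (fderiv ℝ v x a) +
        fderiv ℝ f (v x) (fderiv ℝ (fderiv ℝ v) x b a) := by
  have hv1 := (hv.differentiableAt (by simp)).hasFDerivAt
  have hev : fderiv ℝ (f ∘ v) =ᶠ[𝓝 x] fun y => (fderiv ℝ f (v y)).comp (fderiv ℝ v y) := by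
    filter_upwards [hv.eventually_differentiableAt,
      hv.continuousAt.eventually hf.eventually_differentiableAt] with y hy hy'
    exact fderiv_comp y hy' hy
  have h := ((hf.hasFDerivAt_fderiv).comp x hv1).clm_comp hv.hasFDerivAt_fderiv
  rw [hev.fderiv_eq]
  have h' := h.fderiv
  simp only [Function.comp_def] at h'
  rw [h']
  simp [add_comm]

/-- First derivative of a sum of functions of linear images of the variable. -/
lemma hasFDerivAt_sum_comp_clm {κ : Type*} [Fintype κ] {H : κ → Type*}
    [∀ k, NormedAddCommGroup (H k)] [∀ k, NormedSpace ℝ (H k)] {h : ∀ k, H k → G}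
    {p : ∀ k, E →L[ℝ] H k} {z : E} (hh : ∀ k, DifferentiableAt ℝ (h k) (p k z)) :
    HasFDerivAt (fun z => ∑ k, h k (p k z)) (∑ k, (fderiv ℝ (h k) (p k z)).comp (p k)) z :=
  HasFDerivAt.fun_sum fun k _ => (hh k).hasFDerivAt.comp z (p k).hasFDerivAt

/-- Second derivative of a sum of functions of linear images of the variable. -/
lemma fderiv_fderiv_sum_comp_clm {κ : Type*} [Fintype κ] {H : κ → Type*}
    [∀ k, NormedAddCommGroup (H k)] [∀ k, NormedSpace ℝ (H k)] {h : ∀ k, H k → G}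
    {p : ∀ k, E →L[ℝ] H k} {z : E} (hh : ∀ k, ContDiffAt ℝ 2 (h k) (p k z)) (a b : E) :
    fderiv ℝ (fderiv ℝ fun z => ∑ k, h k (p k z)) z b a =
      ∑ k, fderiv ℝ (fderiv ℝ (h k)) (p k z) (p k b) (p k a) := by
  have hev : (fderiv ℝ fun z => ∑ k, h k (p k z)) =ᶠ[𝓝 z]
      fun y => ∑ k, (fderiv ℝ (h k) (p k y)).comp (p k) := by
    have : ∀ᶠ y in 𝓝 z, ∀ k, DifferentiableAt ℝ (h k) (p k y) :=
      eventually_all.2 fun k =>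
        (p k).continuous.continuousAt.eventually (hh k).eventually_differentiableAt
    filter_upwards [this] with y hy using (hasFDerivAt_sum_comp_clm hy).fderiv
  rw [hev.fderiv_eq]
  have h1 : HasFDerivAt (fun y => ∑ k, (fderiv ℝ (h k) (p k y)).comp (p k)) _ z :=
    HasFDerivAt.fun_sum (u := Finset.univ) fun k _ =>
      ((hh k).hasFDerivAt_fderiv.comp z (p k).hasFDerivAt).clm_comp
        (hasFDerivAt_const (p k) z)
  rw [h1.fderiv]
  simp

end Calculus

/-! ### Coordinates and blocks -/

/-- The subvector `z_B` as a continuous linear map in `z`. -/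
noncomputable def subvecCLM {d : ℕ} (B : Finset (Fin d)) : Vec (Fin d) →L[ℝ] Vec B :=
  LinearMap.toContinuousLinearMap
    { toFun := subvec B
      map_add' := fun _ _ => rfl
      map_smul' := fun _ _ => rfl }

@[simp]
lemma subvecCLM_apply {d : ℕ} (B : Finset (Fin d)) (z : Vec (Fin d)) :
    subvecCLM B z = subvec B z := rfl

@[simp]
lemma subvec_apply {d : ℕ} (B : Finset (Fin d)) (z : Vec (Fin d)) (i : B) :
    subvec B z i = z i := rfl

/-- The block of the partition that contains `i`. -/
def blockOf {d : ℕ} (𝓑 : BlockPartition d) (i : Fin d) : 𝓑.parts :=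
  ⟨𝓑.part i, 𝓑.part_mem.2 (Finset.mem_univ i)⟩

lemma blockOf_eq_iff {d : ℕ} {𝓑 : BlockPartition d} {i : Fin d} {B : 𝓑.parts} :
    blockOf 𝓑 i = B ↔ i ∈ B.1 := by
  rw [Subtype.ext_iff]
  exact 𝓑.part_eq_iff_mem B.2

lemma blockOf_surjective {d : ℕ} (𝓑 : BlockPartition d) : Function.Surjective (blockOf 𝓑) := by
  intro B
  obtain ⟨i, hi⟩ := 𝓑.nonempty_of_mem_parts B.2
  exact ⟨i, blockOf_eq_iff.2 hi⟩

/-- The vector with subvectors `w B`. -/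
def glueBlocks {d : ℕ} {𝓑 : BlockPartition d} (w : ∀ B : 𝓑.parts, Vec B.1) : Vec (Fin d) :=
  WithLp.toLp 2 fun i => w (blockOf 𝓑 i) ⟨i, blockOf_eq_iff.1 rfl⟩

@[simp]
lemma subvec_glueBlocks {d : ℕ} {𝓑 : BlockPartition d} (w : ∀ B : 𝓑.parts, Vec B.1)
    (B : 𝓑.parts) : subvec B.1 (glueBlocks w) = w B := by
  ext ⟨i, hi⟩
  obtain rfl := blockOf_eq_iff.2 hi
  rfl

lemma subvec_surjective {d : ℕ} (B : Finset (Fin d)) : Function.Surjective (subvec B) := by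
  intro w
  refine ⟨WithLp.toLp 2 fun i => if h : i ∈ B then w ⟨i, h⟩ else 0, ?_⟩
  ext ⟨i, hi⟩
  simp [hi]

lemma isOpen_projSet {d : ℕ} (B : Finset (Fin d)) {Z : Set (Vec (Fin d))} (hZ : IsOpen Z) :
    IsOpen (projSet B Z) :=
  (subvecCLM B).isOpenMap (subvec_surjective B) Z hZ

lemma subvec_single_eq_zero {d : ℕ} {B : Finset (Fin d)} {i : Fin d} (hi : i ∉ B) :
    subvec B (EuclideanSpace.single i (1 : ℝ)) = 0 := by
  ext ⟨j, hj⟩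
  have : j ≠ i := by rintro rfl; exact hi hj
  simp [this]

lemma sum_smul_single {ι : Type*} [Fintype ι] [DecidableEq ι] (a : EuclideanSpace ℝ ι) :
    ∑ i, a i • EuclideanSpace.single i (1 : ℝ) = a := by
  ext j
  simp [Finset.sum_apply, Pi.single_apply]

lemma map_eq_sum_single {ι G : Type*} [Fintype ι] [DecidableEq ι] [NormedAddCommGroup G]
    [NormedSpace ℝ G] (T : EuclideanSpace ℝ ι →L[ℝ] G) (a : EuclideanSpace ℝ ι) :
    T a = ∑ i, a i • T (EuclideanSpace.single i 1) := by
  conv_lhs => rw [← sum_smul_single a]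
  simp

/-- A symmetric bilinear map in coordinates, with each unordered pair of indices listed once. -/
lemma bilin_eq_sum_of_symm {ι G : Type*} [Fintype ι] [LinearOrder ι] [NormedAddCommGroup G]
    [NormedSpace ℝ G] (T : EuclideanSpace ℝ ι →L[ℝ] EuclideanSpace ℝ ι →L[ℝ] G)
    (hT : ∀ a b, T a b = T b a) (a b : EuclideanSpace ℝ ι) :
    T a b = ∑ p : {p : ι × ι // p.2 ≤ p.1},
      (if p.1.1 = p.1.2 then a p.1.1 * b p.1.2 else a p.1.1 * b p.1.2 + a p.1.2 * b p.1.1) •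
        T (EuclideanSpace.single p.1.1 1) (EuclideanSpace.single p.1.2 1) := by
  let g : ι × ι → G := fun p =>
    (a p.1 * b p.2) • T (EuclideanSpace.single p.1 1) (EuclideanSpace.single p.2 1)
  have h1 : T a b = ∑ p, g p := by
    rw [map_eq_sum_single T a, _root_.sum_apply, Fintype.sum_prod_type]
    refine Finset.sum_congr rfl fun i _ => ?_
    rw [_root_.smul_apply, map_eq_sum_single (T _) b, Finset.smul_sum]
    simp only [g, mul_smul]
  have h2 : ∑ p, g p = (∑ p : ι × ι, if p.2 ≤ p.1 then g p else 0) +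
      ∑ p : ι × ι, if p.2 < p.1 then g p.swap else 0 := by
    have : (∑ p : ι × ι, if p.2 < p.1 then g p.swap else 0) =
        ∑ p : ι × ι, if p.1 < p.2 then g p else 0 :=
      (Equiv.sum_comp (Equiv.prodComm ι ι) fun p : ι × ι => if p.1 < p.2 then g p else 0)
    rw [this, ← Finset.sum_add_distrib]
    refine Finset.sum_congr rfl fun p _ => ?_
    rcases le_or_gt p.2 p.1 with h | h
    · simp [h, h.not_gt]
    · simp [h, h.not_ge]
  rw [h1, h2, ← Finset.sum_add_distrib]
  have h3 : ∀ p : ι × ι, ((if p.2 ≤ p.1 then g p else 0) + if p.2 < p.1 then g p.swap else 0) =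
      if p.2 ≤ p.1 then
        (if p.1 = p.2 then a p.1 * b p.2 else a p.1 * b p.2 + a p.2 * b p.1) •
          T (EuclideanSpace.single p.1 1) (EuclideanSpace.single p.2 1) else 0 := by
    rintro ⟨i, j⟩
    rcases lt_trichotomy j i with h | rfl | h
    · simp only [h.le, h, h.ne', if_true, if_false, g, Prod.swap]
      rw [hT (EuclideanSpace.single j 1), add_smul]
    · simp [g]
    · simp [h.not_ge, h.not_gt]
  rw [Finset.sum_congr rfl fun p _ => h3 p, ← Finset.sum_filter]
  exact Finset.sum_subtype _ (by simp) _

/-! ### Additive functions -/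

/-- The additive function `z ↦ ∑_B h_B(z_B)`. -/
def blockSum {d n : ℕ} {𝓑 : BlockPartition d} (h : ∀ B : 𝓑.parts, Vec B.1 → Vec (Fin n))
    (z : Vec (Fin d)) : Vec (Fin n) :=
  ∑ B : 𝓑.parts, h B (subvec B.1 z)

section Additive

variable {d n : ℕ} {𝓑 : BlockPartition d} {h : ∀ B : 𝓑.parts, Vec B.1 → Vec (Fin n)}
  {z : Vec (Fin d)}

lemma contDiffAt_blockSum (hh : ∀ B, ContDiffAt ℝ 2 (h B) (subvec B.1 z)) :
    ContDiffAt ℝ 2 (blockSum h) z :=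
  ContDiffAt.sum fun B _ => (hh B).comp z (subvecCLM B.1).contDiff.contDiffAt

lemma fderiv_blockSum (hh : ∀ B, ContDiffAt ℝ 2 (h B) (subvec B.1 z)) (a : Vec (Fin d)) :
    fderiv ℝ (blockSum h) z a = ∑ B : 𝓑.parts, fderiv ℝ (h B) (subvec B.1 z) (subvec B.1 a) := by
  have := (hasFDerivAt_sum_comp_clm (p := fun B : 𝓑.parts => subvecCLM B.1) (h := h) (z := z)
    fun B => (hh B).differentiableAt (by simp)).fderiv
  calc fderiv ℝ (blockSum h) z a
      = (∑ B : 𝓑.parts, (fderiv ℝ (h B) (subvecCLM B.1 z)).comp (subvecCLM B.1)) a :=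
        congrArg (fun T => T a) this
    _ = _ := by simp

lemma fderiv_fderiv_blockSum (hh : ∀ B, ContDiffAt ℝ 2 (h B) (subvec B.1 z))
    (a b : Vec (Fin d)) :
    fderiv ℝ (fderiv ℝ (blockSum h)) z b a =
      ∑ B : 𝓑.parts, fderiv ℝ (fderiv ℝ (h B)) (subvec B.1 z) (subvec B.1 b) (subvec B.1 a) :=
  fderiv_fderiv_sum_comp_clm (p := fun B : 𝓑.parts => subvecCLM B.1) (h := h) hh a b

/-- The mixed second derivatives of an additive function in two different blocks vanish. -/
lemma fderiv_fderiv_blockSum_single (hh : ∀ B, ContDiffAt ℝ 2 (h B) (subvec B.1 z))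
    {i i' : Fin d} (hi : blockOf 𝓑 i ≠ blockOf 𝓑 i') :
    fderiv ℝ (fderiv ℝ (blockSum h)) z (EuclideanSpace.single i 1)
      (EuclideanSpace.single i' 1) = 0 := by
  rw [fderiv_fderiv_blockSum hh]
  refine Finset.sum_eq_zero fun B _ => ?_
  by_cases hB : i ∈ B.1
  · have : i' ∉ B.1 := fun hB' => hi ((blockOf_eq_iff.2 hB).trans (blockOf_eq_iff.2 hB').symm)
    rw [subvec_single_eq_zero this, map_zero]
  · rw [subvec_single_eq_zero hB, map_zero, _root_.zero_apply]

/-- Sufficient nonlinearity turns a linear relation between the first and the second derivatives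
of an additive function into relations between the directions of differentiation. -/
lemma eq_zero_of_linearIndependent_colW (hh : ∀ B, ContDiffAt ℝ 2 (h B) (subvec B.1 z))
    (hli : LinearIndependent ℝ (colW 𝓑 h z)) {p q y : Vec (Fin d)}
    (heq : fderiv ℝ (fderiv ℝ (blockSum h)) z p q + fderiv ℝ (blockSum h) z y = 0)
    {j j' : Fin d} (hj : blockOf 𝓑 j = blockOf 𝓑 j') : p j * q j' + p j' * q j = 0 := by
  let c : ColIndex 𝓑 → ℝ
    | ⟨_, Sum.inl i⟩ => y i
    | ⟨_, Sum.inr r⟩ => if r.1.1 = r.1.2 then p r.1.1 * q r.1.2 else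
        p r.1.1 * q r.1.2 + p r.1.2 * q r.1.1
  have hsum : ∑ k, c k • colW 𝓑 h z k = 0 := by
    rw [← heq, fderiv_fderiv_blockSum hh, fderiv_blockSum hh, Fintype.sum_sigma,
      ← Finset.sum_add_distrib]
    refine Finset.sum_congr rfl fun B _ => ?_
    rw [Fintype.sum_sum_type, add_comm]
    congr 1
    · have hsymm := (hh B).isSymmSndFDerivAt (by simp)
      rw [bilin_eq_sum_of_symm _ hsymm]
      refine Finset.sum_congr rfl fun r _ => ?_
      have : partialD r.1.1 (partialD r.1.2 (h B)) (subvec B.1 z) =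
          fderiv ℝ (fderiv ℝ (h B)) (subvec B.1 z) (EuclideanSpace.single r.1.1 1)
            (EuclideanSpace.single r.1.2 1) := by
        have h1 := ((hh B).hasFDerivAt_fderiv.clm_apply
          (hasFDerivAt_const (EuclideanSpace.single r.1.2 (1 : ℝ)) (subvec B.1 z))).fderiv
        unfold partialD
        rw [h1]
        simp
      simp only [c, colW, this, subvec_apply]
      congr!
    · rw [map_eq_sum_single]
      rfl
  have hc := Fintype.linearIndependent_iff.1 hli c hsum
  have key : ∀ j j' : Fin d, blockOf 𝓑 j = blockOf 𝓑 j' → j' ≤ j →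
      p j * q j' + p j' * q j = 0 := by
    intro j j' hj hle
    have h0 := hc ⟨blockOf 𝓑 j, Sum.inr ⟨(⟨j, blockOf_eq_iff.1 rfl⟩,
      ⟨j', blockOf_eq_iff.1 hj.symm⟩), hle⟩⟩
    simp only [c, Subtype.mk.injEq] at h0
    split_ifs at h0 with hjj
    · subst hjj
      linarith
    · exact h0
  rcases le_total j' j with hle | hle
  · exact key j j' hj hle
  · linarith [key j' j hj.symm hle]

end Additive

/-! ### Smooth reparametrisations of regularly closed sets -/

/-- `u` is a `C²` change of coordinates on `Z` with `C²` inverse `v`, where both maps are smooth on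
neighbourhoods of the points of `Z` and of `u '' Z`, and interior points are dense in `Z`. -/
structure IsC2Reparam {d : ℕ} (Z : Set (Vec (Fin d))) (u v : Vec (Fin d) → Vec (Fin d)) :
    Prop where
  subset_closure : Z ⊆ closure (interior Z)
  c2 : ∀ z ∈ Z, ContDiffAt ℝ 2 u z
  c2_inv : ∀ z ∈ Z, ContDiffAt ℝ 2 v (u z)
  left_inv : ∀ z ∈ Z, v (u z) = z

/-- The Jacobian matrix of `v` at `x`. -/
noncomputable def jacobianMatrix {d : ℕ} (v : Vec (Fin d) → Vec (Fin d)) (x : Vec (Fin d)) :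
    Matrix (Fin d) (Fin d) ℝ :=
  Matrix.of fun j i => fderiv ℝ v x (EuclideanSpace.single i 1) j

lemma fderiv_apply_eq_sum_jacobianMatrix {d : ℕ} (v : Vec (Fin d) → Vec (Fin d))
    (x a : Vec (Fin d)) (j : Fin d) :
    fderiv ℝ v x a j = ∑ i, a i * jacobianMatrix v x j i := by
  rw [map_eq_sum_single]
  simp [jacobianMatrix]

namespace IsC2Reparam

variable {d n : ℕ} {Z : Set (Vec (Fin d))} {u v : Vec (Fin d) → Vec (Fin d)}
  (hr : IsC2Reparam Z u v)
include hr

/-- Two functions that are continuous on `Z` and agree on the interior of `Z` agree on `Z`. -/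
lemma eq_of_interior {Y : Type*} [TopologicalSpace Y] [T2Space Y] {f g : Vec (Fin d) → Y}
    (hf : ContinuousOn f Z) (hg : ContinuousOn g Z) (h : ∀ z ∈ interior Z, f z = g z)
    {z : Vec (Fin d)} (hz : z ∈ Z) : f z = g z :=
  Set.EqOn.of_subset_closure h hf hg interior_subset hr.subset_closure hz

lemma continuousOn_fderiv : ContinuousOn (fderiv ℝ u) Z := fun z hz =>
  ((hr.c2 z hz).continuousAt_fderiv (by simp)).continuousWithinAt

lemma continuousOn_fderiv_inv : ContinuousOn (fun z => fderiv ℝ v (u z)) Z := fun z hz =>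
  (((hr.c2_inv z hz).continuousAt_fderiv (by simp)).comp
    (hr.c2 z hz).continuousAt).continuousWithinAt

lemma continuousOn_jacobianMatrix (j i : Fin d) :
    ContinuousOn (fun z => jacobianMatrix v (u z) j i) Z :=
  (EuclideanSpace.proj (𝕜 := ℝ) j).continuous.comp_continuousOn
    (hr.continuousOn_fderiv_inv.clm_apply continuousOn_const)

/-- The derivatives of `v` and `u` are inverse to each other on all of `Z`; at boundary points this
follows by continuity. -/
lemma fderiv_inv_fderiv {z : Vec (Fin d)} (hz : z ∈ Z) (a : Vec (Fin d)) :
    fderiv ℝ v (u z) (fderiv ℝ u z a) = a := by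
  refine hr.eq_of_interior (f := fun z => fderiv ℝ v (u z) (fderiv ℝ u z a))
    (hr.continuousOn_fderiv_inv.clm_apply (hr.continuousOn_fderiv.clm_apply continuousOn_const))
    continuousOn_const (fun z hz => ?_) hz
  have hzZ := interior_subset hz
  have hev : v ∘ u =ᶠ[𝓝 z] id := by
    filter_upwards [mem_interior_iff_mem_nhds.1 hz] with y hy using hr.left_inv y hy
  have h := fderiv_comp z ((hr.c2_inv z hzZ).differentiableAt (by simp))
    ((hr.c2 z hzZ).differentiableAt (by simp))
  rw [hev.fderiv_eq, fderiv_id] at h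
  exact (congrArg (fun T => T a) h).symm

lemma det_jacobianMatrix_ne_zero {z : Vec (Fin d)} (hz : z ∈ Z) :
    (jacobianMatrix v (u z)).det ≠ 0 := by
  refine Matrix.det_ne_zero_of_right_inverse (B := jacobianMatrix u z) ?_
  ext j k
  have h := congrArg (fun w : Vec (Fin d) => w j)
    (hr.fderiv_inv_fderiv hz (EuclideanSpace.single k 1))
  simp only [fderiv_apply_eq_sum_jacobianMatrix v] at h
  rw [Matrix.mul_apply, Matrix.one_apply]
  simpa [mul_comm, jacobianMatrix, Pi.single_apply] using h

/-- By the inverse function theorem, points near the image of an interior point are images of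
interior points. -/
lemma eventually_mem_image {z : Vec (Fin d)} (hz : z ∈ interior Z) :
    ∀ᶠ y in 𝓝 (u z), ∃ w ∈ interior Z, u w = y := by
  have hzZ := interior_subset hz
  have hinj : Function.Injective (fderiv ℝ u z) := fun a b hab => by
    rw [← hr.fderiv_inv_fderiv hzZ a, hab, hr.fderiv_inv_fderiv hzZ b]
  have hsurj : (fderiv ℝ u z).range = ⊤ :=
    LinearMap.range_eq_top.2 (LinearMap.injective_iff_surjective.1 hinj)
  rw [← ((hr.c2 z hzZ).hasStrictFDerivAt (by simp)).map_nhds_eq_of_surj hsurj]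
  exact image_mem_map (isOpen_interior.mem_nhds hz)

variable {F Fhat : Vec (Fin d) → Vec (Fin n)} (heq : ∀ z ∈ Z, Fhat (u z) = F z)
include heq

lemma eventuallyEq_comp_inv {z : Vec (Fin d)} (hz : z ∈ interior Z) :
    Fhat =ᶠ[𝓝 (u z)] F ∘ v := by
  filter_upwards [hr.eventually_mem_image hz] with y hy
  obtain ⟨w, hw, rfl⟩ := hy
  have hwZ := interior_subset hw
  rw [Function.comp_apply, hr.left_inv w hwZ, heq w hwZ]

lemma fderiv_apply_eq (hF : ∀ z ∈ Z, ContDiffAt ℝ 2 F z)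
    (hFhat : ∀ z ∈ Z, ContDiffAt ℝ 2 Fhat (u z)) {z : Vec (Fin d)} (hz : z ∈ Z)
    (a : Vec (Fin d)) : fderiv ℝ Fhat (u z) a = fderiv ℝ F z (fderiv ℝ v (u z) a) := by
  have hF' : ContinuousOn (fderiv ℝ F) Z := fun z hz =>
    ((hF z hz).continuousAt_fderiv (by simp)).continuousWithinAt
  have hFhat' : ContinuousOn (fun z => fderiv ℝ Fhat (u z)) Z := fun z hz =>
    (((hFhat z hz).continuousAt_fderiv (by simp)).comp
      (hr.c2 z hz).continuousAt).continuousWithinAt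
  refine hr.eq_of_interior (hFhat'.clm_apply continuousOn_const)
    (hF'.clm_apply (hr.continuousOn_fderiv_inv.clm_apply continuousOn_const))
    (fun z hz => ?_) hz
  have hzZ := interior_subset hz
  have hFz := hF z hzZ
  rw [← hr.left_inv z hzZ] at hFz
  rw [(hr.eventuallyEq_comp_inv heq hz).fderiv_eq, fderiv_comp _ (hFz.differentiableAt (by simp))
    ((hr.c2_inv z hzZ).differentiableAt (by simp)), hr.left_inv z hzZ]
  rfl

omit heq

/-- The mixed second derivatives of `∑_B ĥ_B` in two different blocks vanish. Expanding them
through `∑_B h_B ∘ v` and using sufficient nonlinearity gives product relations between the entries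
of the Jacobian matrix of `v`. -/
lemma jacobianMatrix_mul_add_mul {𝓑 : BlockPartition d}
    {h hhat : ∀ B : 𝓑.parts, Vec B.1 → Vec (Fin n)}
    (heq : ∀ z ∈ Z, blockSum hhat (u z) = blockSum h z)
    (hh : ∀ z ∈ Z, ∀ B : 𝓑.parts, ContDiffAt ℝ 2 (h B) (subvec B.1 z))
    (hhhat : ∀ z ∈ Z, ∀ B : 𝓑.parts, ContDiffAt ℝ 2 (hhat B) (subvec B.1 (u z)))
    (hli : IsSufficientlyNonlinear 𝓑 h Z) {z : Vec (Fin d)} (hz : z ∈ Z) {i i' j j' : Fin d}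
    (hi : blockOf 𝓑 i ≠ blockOf 𝓑 i') (hj : blockOf 𝓑 j = blockOf 𝓑 j') :
    jacobianMatrix v (u z) j i * jacobianMatrix v (u z) j' i' +
      jacobianMatrix v (u z) j' i * jacobianMatrix v (u z) j i' = 0 := by
  have hc := hr.continuousOn_jacobianMatrix
  refine hr.eq_of_interior (((hc j i).mul (hc j' i')).add ((hc j' i).mul (hc j i')))
    continuousOn_const (fun z hz => ?_) hz
  have hzZ := interior_subset hz
  have h2 := fderiv_fderiv_blockSum_single (hhhat z hzZ) hi
  rw [(hr.eventuallyEq_comp_inv heq hz).fderiv.fderiv_eq,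
    fderiv_fderiv_comp ((hr.left_inv z hzZ).symm ▸ contDiffAt_blockSum (hh z hzZ))
      (hr.c2_inv z hzZ), hr.left_inv z hzZ] at h2
  exact eq_zero_of_linearIndependent_colW (hh z hzZ) (hli z hzZ) h2 hj

/-- Suppose that the block `C` of `v` depends to first order only on the block `B`, and no other
block of `v` depends on it. Then `ĥ_B` of the block `B` of `u z` and `h_C` of the block `C` of `z`
differ by a constant, since the difference has zero derivative along every path in `Z`. -/
lemma block_sub_block_eq {𝓑 : BlockPartition d}
    {h hhat : ∀ B : 𝓑.parts, Vec B.1 → Vec (Fin n)}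
    (heq : ∀ z ∈ Z, blockSum hhat (u z) = blockSum h z)
    (hh : ∀ z ∈ Z, ∀ B : 𝓑.parts, ContDiffAt ℝ 2 (h B) (subvec B.1 z))
    (hhhat : ∀ z ∈ Z, ∀ B : 𝓑.parts, ContDiffAt ℝ 2 (hhat B) (subvec B.1 (u z)))
    (hpath : IsC1PathConnected Z) {B C : 𝓑.parts}
    (hsparse : ∀ z ∈ Z, ∀ i j, (i ∈ B.1 ↔ j ∉ C.1) → jacobianMatrix v (u z) j i = 0)
    {z z' : Vec (Fin d)} (hz : z ∈ Z) (hz' : z' ∈ Z) :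
    hhat B (subvec B.1 (u z')) - h C (subvec C.1 z') =
      hhat B (subvec B.1 (u z)) - h C (subvec C.1 z) := by
  -- the derivatives of the two terms agree in every direction
  have hderiv : ∀ z ∈ Z, ∀ a, fderiv ℝ (hhat B) (subvec B.1 (u z)) (subvec B.1 (fderiv ℝ u z a)) =
      fderiv ℝ (h C) (subvec C.1 z) (subvec C.1 a) := by
    intro z hz a
    set b := fderiv ℝ u z a with hb
    have hba : fderiv ℝ v (u z) b = a := hr.fderiv_inv_fderiv hz a
    -- `b'` keeps the block `B` of `b`, so its image under `Dv` keeps the block `C` of `a`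
    let b' : Vec (Fin d) := WithLp.toLp 2 fun i => if i ∈ B.1 then b i else 0
    have hb'B : subvec B.1 b' = subvec B.1 b := by
      ext ⟨i, hi⟩
      simp [b', hi]
    have hb'ne : ∀ B' : 𝓑.parts, B' ≠ B → subvec B'.1 b' = 0 := by
      intro B' hB'
      ext ⟨i, hi⟩
      have : i ∉ B.1 := fun hi' => hB' ((blockOf_eq_iff.2 hi).symm.trans (blockOf_eq_iff.2 hi'))
      simp [b', this]
    have hvC : subvec C.1 (fderiv ℝ v (u z) b') = subvec C.1 a := by
      ext ⟨j, hj⟩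
      rw [← hba]
      simp only [subvec_apply]
      rw [fderiv_apply_eq_sum_jacobianMatrix, fderiv_apply_eq_sum_jacobianMatrix]
      refine Finset.sum_congr rfl fun i _ => ?_
      by_cases hi : i ∈ B.1
      · simp [b', hi]
      · rw [hsparse z hz i j (by simp [hi, hj])]
        simp
    have hvne : ∀ C' : 𝓑.parts, C' ≠ C → subvec C'.1 (fderiv ℝ v (u z) b') = 0 := by
      intro C' hC'
      ext ⟨j, hj⟩
      have hjC : j ∉ C.1 := fun hj' => hC' ((blockOf_eq_iff.2 hj).symm.trans (blockOf_eq_iff.2 hj'))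
      simp only [subvec_apply]
      rw [fderiv_apply_eq_sum_jacobianMatrix]
      refine Finset.sum_eq_zero fun i _ => ?_
      by_cases hi : i ∈ B.1
      · rw [hsparse z hz i j (by simp [hi, hjC]), mul_zero]
      · simp [b', hi]
    have h1 := hr.fderiv_apply_eq heq (fun z hz => contDiffAt_blockSum (hh z hz))
      (fun z hz => contDiffAt_blockSum (hhhat z hz)) hz b'
    rw [fderiv_blockSum (hhhat z hz), fderiv_blockSum (hh z hz),
      Finset.sum_eq_single B (fun B' _ hB' => by rw [hb'ne B' hB', map_zero]) (by simp),
      Finset.sum_eq_single C (fun C' _ hC' => by rw [hvne C' hC', map_zero]) (by simp),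
      hb'B, hvC] at h1
    exact h1
  obtain ⟨φ, hφ, hφZ, rfl, rfl⟩ := hpath z hz z' hz'
  have hD : ∀ t ∈ Set.Icc (0 : ℝ) 1, HasDerivWithinAt
      (fun t => hhat B (subvec B.1 (u (φ t))) - h C (subvec C.1 (φ t))) 0 (Set.Icc 0 1) t := by
    intro t ht
    have hφt : HasDerivWithinAt φ (derivWithin φ (Set.Icc 0 1) t) (Set.Icc 0 1) t :=
      ((hφ t ht).differentiableWithinAt (by simp)).hasDerivWithinAt
    have hZt := hφZ ht
    have hu := ((hr.c2 _ hZt).differentiableAt (by simp)).hasFDerivAt.comp_hasDerivWithinAt t hφt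
    have hBu := (subvecCLM B.1).hasFDerivAt.comp_hasDerivWithinAt t hu
    have hCz := (subvecCLM C.1).hasFDerivAt.comp_hasDerivWithinAt t hφt
    have h1 := ((hhhat _ hZt B).differentiableAt (by simp)).hasFDerivAt.comp_hasDerivWithinAt t hBu
    have h2 := ((hh _ hZt C).differentiableAt (by simp)).hasFDerivAt.comp_hasDerivWithinAt t hCz
    have h3 := h1.sub h2
    simp only [subvecCLM_apply, hderiv _ hZt, sub_self] at h3
    exact h3
  refine constant_of_derivWithin_zero (a := 0) (b := 1)
    (fun t ht => (hD t ht).differentiableWithinAt)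
    (fun t ht => (hD t (Set.Ico_subset_Icc_self ht)).derivWithin
      (uniqueDiffOn_Icc_zero_one t (Set.Ico_subset_Icc_self ht))) 1 (by simp)

end IsC2Reparam

/-! ### The change of latent coordinates -/

lemma IsC2On.contDiffAt {E F : Type} [NormedAddCommGroup E] [NormedSpace ℝ E]
    [NormedAddCommGroup F] [NormedSpace ℝ F] {f : E → F} {A : Set E} (hf : IsC2On f A)
    (hA : IsOpen A) {x : E} (hx : x ∈ A) : ContDiffAt ℝ 2 f x := by
  obtain ⟨U, g, hU, hAU, hg, hfg⟩ := hf
  refine (hg.contDiffAt (hU.mem_nhds (hAU hx))).congr_of_eventuallyEq ?_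
  filter_upwards [hA.mem_nhds hx] with y hy using hfg hy

lemma isC2On_of_contDiffAt {E F : Type} [NormedAddCommGroup E] [NormedSpace ℝ E]
    [NormedAddCommGroup F] [NormedSpace ℝ F] {f g : E → F} {A : Set E}
    (hg : ∀ x ∈ A, ContDiffAt ℝ 2 g x) (hfg : Set.EqOn f g A) : IsC2On f A :=
  ⟨{x | ContDiffAt ℝ 2 g x}, g,
    isOpen_iff_mem_nhds.2 fun _ hx => ContDiffAt.eventually hx (by simp), hg,
    fun _ hx => ContDiffAt.contDiffWithinAt hx, hfg⟩

/-- A nonnegative function with zero integral vanishes at the points of the support of the measure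
at which it is continuous; no measurability is needed. -/
lemma eq_zero_of_mem_support_of_lintegral_eq_zero {X : Type*} [TopologicalSpace X]
    [MeasurableSpace X] [OpensMeasurableSpace X] {μ : Measure X} {h : X → ENNReal}
    (hint : ∫⁻ x, h x ∂μ = 0) {x : X} (hx : x ∈ μ.support) (hh : ContinuousAt h x) : h x = 0 := by
  by_contra hne
  obtain ⟨c, hc0, hc⟩ := exists_between (pos_iff_ne_zero.2 hne)
  obtain ⟨U, hUc, hU, hxU⟩ := eventually_nhds_iff.1 (hh.eventually (lt_mem_nhds hc))
  have hpos : 0 < μ U := (Measure.mem_support_iff_forall x).1 hx U (hU.mem_nhds hxU)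
  have hle : c * μ U ≤ 0 := calc
    c * μ U = ∫⁻ _ in U, c ∂μ := (setLIntegral_const U c).symm
    _ ≤ ∫⁻ x in U, h x ∂μ := setLIntegral_mono' hU.measurableSet fun x hx => (hUc x hx).le
    _ ≤ ∫⁻ x, h x ∂μ := setLIntegral_le_lintegral U h
    _ = 0 := hint
  exact (ENNReal.mul_pos hc0.ne' hpos.ne').not_ge hle

section Decoder

variable {d n : ℕ} {Ztest Ztrain : Set (Vec (Fin d))} {f fhat : Vec (Fin d) → Vec (Fin n)}
  {P : Measure (Vec (Fin d))} {ghat : Vec (Fin n) → Vec (Fin d)}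

/-- Zero expected error gives exact reconstruction at every point of the training support, not only
almost everywhere, because the error is continuous there. -/
lemma fhat_ghat_f_eq (hdata : IsDataGenerating Ztest Ztrain f P)
    (hfhat : IsC2DiffeoOntoImage fhat Set.univ) (hghat : Continuous ghat)
    (hrec : SolvesReconstruction P f fhat ghat) {z : Vec (Fin d)} (hz : z ∈ Ztrain) :
    fhat (ghat (f z)) = f z := by
  have hf : ContinuousAt f z :=
    (hdata.diffeo.2.1.contDiffAt hdata.isOpen_test (hdata.train_subset_test hz)).continuousAt
  have hfh : Continuous fhat := continuous_iff_continuousAt.2 fun x =>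
    (hfhat.2.1.contDiffAt isOpen_univ (Set.mem_univ x)).continuousAt
  have hg : ContinuousAt (fun z => f z - fhat (ghat (f z))) z :=
    hf.sub ((hfh.comp hghat).continuousAt.comp hf)
  have h := eq_zero_of_mem_support_of_lintegral_eq_zero hrec (hdata.support_eq ▸ hz)
    ((ENNReal.continuous_pow 2).continuousAt.comp hg.enorm)
  have h0 : f z - fhat (ghat (f z)) = 0 := by simpa using h
  exact (sub_eq_zero.1 h0).symm

lemma vMap_ghat_f_eq (hdata : IsDataGenerating Ztest Ztrain f P)
    (hrec : ∀ z ∈ Ztrain, fhat (ghat (f z)) = f z) {z : Vec (Fin d)} (hz : z ∈ Ztrain) :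
    vMap Ztest f fhat (ghat (f z)) = z := by
  rw [vMap, hrec z hz]
  exact hdata.diffeo.1.injOn.leftInvOn_invFunOn (hdata.train_subset_test hz)

/-- The encoded latents `ĝ ∘ f` and the map `f⁻¹ ∘ f̂` have smooth extensions which make up a change
of coordinates on the training support. -/
lemma exists_isC2Reparam (hdata : IsDataGenerating Ztest Ztrain f P)
    (hfhat : IsC2DiffeoOntoImage fhat Set.univ)
    (hrec : ∀ z ∈ Ztrain, fhat (ghat (f z)) = f z) :
    ∃ u v, IsC2Reparam Ztrain u v ∧ ∀ z ∈ Ztrain, u z = ghat (f z) := by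
  have hfC2 := fun z hz => hdata.diffeo.2.1.contDiffAt hdata.isOpen_test (x := z) hz
  have hfhC2 := fun x => hfhat.2.1.contDiffAt isOpen_univ (Set.mem_univ x)
  obtain ⟨-, -, g, hg, U, g', hU, hgU, hg', hgg'⟩ := hfhat
  obtain ⟨-, -, k, hk, V, k', hV, hkV, hk', hkk'⟩ := hdata.diffeo
  have hmem : ∀ z ∈ Ztrain, f z ∈ fhat '' Set.univ := fun z hz => ⟨_, Set.mem_univ _, hrec z hz⟩
  have hmem' : ∀ z ∈ Ztrain, f z ∈ f '' Ztest := fun z hz =>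
    Set.mem_image_of_mem f (hdata.train_subset_test hz)
  have hu : ∀ z ∈ Ztrain, g' (f z) = ghat (f z) := by
    intro z hz
    rw [← hgg' (hmem z hz)]
    conv_lhs => rw [← hrec z hz]
    exact hg.1 (Set.mem_univ _)
  refine ⟨g' ∘ f, k' ∘ fhat, ⟨?_, ?_, ?_, ?_⟩, hu⟩
  · exact hdata.regularlyClosed.le
  · intro z hz
    exact (hg'.contDiffAt (hU.mem_nhds (hgU (hmem z hz)))).comp z
      (hfC2 z (hdata.train_subset_test hz))
  · intro z hz
    rw [Function.comp_apply, hu z hz]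
    refine ContDiffAt.comp _ ?_ (hfhC2 _)
    rw [hrec z hz]
    exact hk'.contDiffAt (hV.mem_nhds (hkV (hmem' z hz)))
  · intro z hz
    rw [Function.comp_apply, Function.comp_apply, hu z hz, hrec z hz, ← hkk' (hmem' z hz)]
    exact hk.1 (hdata.train_subset_test hz)

end Decoder

lemma IsC1PathConnected.isPreconnected {E : Type} [NormedAddCommGroup E] [NormedSpace ℝ E]
    {Z : Set E} (hZ : IsC1PathConnected Z) : IsPreconnected Z := by
  refine isPreconnected_of_forall_pair fun x hx y hy => ?_
  obtain ⟨φ, hφ, hφZ, rfl, rfl⟩ := hZ x hx y hy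
  exact ⟨φ '' Set.Icc 0 1, hφZ.image_subset, ⟨0, by simp, rfl⟩, ⟨1, by simp, rfl⟩,
    isPreconnected_Icc.image φ hφ.continuousOn⟩

/-! ### Permutations of the blocks -/

section Permutation

variable {d : ℕ} {𝓑 : BlockPartition d} {π : Equiv.Perm (Fin d)}

lemma respectsPartition_of_blockOf_iff
    (hπ : ∀ i i', blockOf 𝓑 (π i) = blockOf 𝓑 (π i') ↔ blockOf 𝓑 i = blockOf 𝓑 i') :
    RespectsPartition 𝓑 π := by
  intro B hB
  obtain ⟨i, hi⟩ := 𝓑.nonempty_of_mem_parts hB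
  have : B.map π.toEmbedding = (blockOf 𝓑 (π i)).1 := by
    ext j
    rw [Finset.mem_map_equiv, ← blockOf_eq_iff (B := blockOf 𝓑 (π i)),
      ← blockOf_eq_iff (B := ⟨B, hB⟩), ← (blockOf_eq_iff (B := ⟨B, hB⟩)).2 hi, ← hπ,
      Equiv.apply_symm_apply]
  exact this ▸ (blockOf 𝓑 (π i)).2

lemma mem_permBlock {hπ : RespectsPartition 𝓑 π} {B : 𝓑.parts} {j : Fin d} :
    j ∈ (permBlock hπ B).1 ↔ π.symm j ∈ B.1 :=
  Finset.mem_map_equiv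

lemma permBlock_bijective (hπ : RespectsPartition 𝓑 π) : Function.Bijective (permBlock hπ) :=
  Finite.injective_iff_bijective.1 fun _ _ h =>
    Subtype.ext (Finset.map_injective _ (congrArg Subtype.val h))

end Permutation

/-! ### Disentanglement and extrapolation -/

section Disentanglement

variable {d n : ℕ} {𝓑 : BlockPartition d} {Ztest Ztrain : Set (Vec (Fin d))}
  {f fhat : Vec (Fin d) → Vec (Fin n)} {u v : Vec (Fin d) → Vec (Fin d)}
  {h hhat : ∀ B : 𝓑.parts, Vec B.1 → Vec (Fin n)}
  {π : Equiv.Perm (Fin d)} {hπ : RespectsPartition 𝓑 π}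

/-- If each block `π(B)` of `v` is a function of the block `B` alone, then so it is to first
order. -/
lemma IsC2Reparam.jacobianMatrix_eq_zero (hr : IsC2Reparam Ztrain u v)
    {vbar : ∀ B : 𝓑.parts, Vec B.1 → Vec (permBlock hπ B).1}
    (hvbar : ∀ B : 𝓑.parts, ∀ z ∈ Ztrain,
      subvec (permBlock hπ B).1 z = vbar B (subvec B.1 (u z)))
    {z : Vec (Fin d)} (hz : z ∈ Ztrain) {i j : Fin d}
    (hij : blockOf 𝓑 i ≠ blockOf 𝓑 (π.symm j)) : jacobianMatrix v (u z) j i = 0 := by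
  refine hr.eq_of_interior (hr.continuousOn_jacobianMatrix j i) continuousOn_const
    (fun z hz => ?_) hz
  have hzZ := interior_subset hz
  set B := blockOf 𝓑 (π.symm j)
  have hiB : i ∉ B.1 := fun hi => hij (blockOf_eq_iff.2 hi)
  have hjB : j ∈ (permBlock hπ B).1 := mem_permBlock.2 (blockOf_eq_iff.1 rfl)
  let l : ℝ → Vec (Fin d) := fun t => u z + t • EuclideanSpace.single i (1 : ℝ)
  have hl : HasDerivAt l (EuclideanSpace.single i (1 : ℝ)) 0 := by
    simpa only [one_smul, id] using ((hasDerivAt_id (0 : ℝ)).smul_const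
      (EuclideanSpace.single i (1 : ℝ))).const_add (u z)
  have hl0 : l 0 = u z := by simp [l]
  have hv : HasFDerivAt v (fderiv ℝ v (u z)) (l 0) := by
    rw [hl0]
    exact ((hr.c2_inv z hzZ).differentiableAt (by simp)).hasFDerivAt
  have h1 := (EuclideanSpace.proj (𝕜 := ℝ) j).hasFDerivAt.comp_hasDerivAt (0 : ℝ)
    (hv.comp_hasDerivAt (0 : ℝ) hl)
  -- along the line through `u z` in direction `i`, the block `B` and hence `v j` stay constant
  have hconst : (fun t => v (l t) j) =ᶠ[𝓝 0] fun _ => vbar B (subvec B.1 (u z)) ⟨j, hjB⟩ := by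
    have hev := hl.continuousAt.eventually (hl0.symm ▸ hr.eventually_mem_image hz)
    filter_upwards [hev] with t ht
    obtain ⟨w, hw, hwt⟩ := ht
    have hwZ := interior_subset hw
    have hsub : subvec B.1 (u w) = subvec B.1 (u z) := by
      rw [hwt]
      have : subvec B.1 (l t) = subvec B.1 (u z) +
          t • subvec B.1 (EuclideanSpace.single i (1 : ℝ)) := rfl
      rw [this, subvec_single_eq_zero hiB, smul_zero, add_zero]
    rw [← hwt, hr.left_inv w hwZ, ← hsub, ← hvbar B w hwZ]
    rfl
  exact h1.unique ((hasDerivAt_const (0 : ℝ) _).congr_of_eventuallyEq hconst)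

/-- The block functions of the two decoders differ by constants along the change of coordinates. -/
lemma IsC2Reparam.block_sub_permBlock_eq (hr : IsC2Reparam Ztrain u v)
    (heq : ∀ z ∈ Ztrain, blockSum hhat (u z) = blockSum h z)
    (hh : ∀ z ∈ Ztrain, ∀ B : 𝓑.parts, ContDiffAt ℝ 2 (h B) (subvec B.1 z))
    (hhhat : ∀ z ∈ Ztrain, ∀ B : 𝓑.parts, ContDiffAt ℝ 2 (hhat B) (subvec B.1 (u z)))
    (hpath : IsC1PathConnected Ztrain)
    (hsparse : ∀ z ∈ Ztrain, ∀ i j, blockOf 𝓑 i ≠ blockOf 𝓑 (π.symm j) →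
      jacobianMatrix v (u z) j i = 0)
    (B : 𝓑.parts) {z z' : Vec (Fin d)} (hz : z ∈ Ztrain) (hz' : z' ∈ Ztrain) :
    hhat B (subvec B.1 (u z')) - h (permBlock hπ B) (subvec (permBlock hπ B).1 z') =
      hhat B (subvec B.1 (u z)) - h (permBlock hπ B) (subvec (permBlock hπ B).1 z) := by
  refine hr.block_sub_block_eq heq hh hhhat hpath (fun z hz i j hij => hsparse z hz i j ?_) hz hz'
  intro hb
  rw [mem_permBlock, ← blockOf_eq_iff, ← blockOf_eq_iff, hb] at hij
  exact iff_not_self hij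

end Disentanglement

/-- For the permutation of blocks found by `exists_perm_of_blockwise`, injectivity of the block
functions recovers the block `π(B)` of `z` from the block `B` of `u z`, on all of the training
support. -/
lemma IsC2Reparam.exists_block_maps {d n : ℕ} {𝓑 : BlockPartition d} {Ztrain : Set (Vec (Fin d))}
    {u v : Vec (Fin d) → Vec (Fin d)} {h hhat : ∀ B : 𝓑.parts, Vec B.1 → Vec (Fin n)}
    (hr : IsC2Reparam Ztrain u v)
    (heq : ∀ z ∈ Ztrain, blockSum hhat (u z) = blockSum h z)
    (hh : ∀ z ∈ Ztrain, ∀ B : 𝓑.parts, ContDiffAt ℝ 2 (h B) (subvec B.1 z))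
    (hhhat : ∀ z ∈ Ztrain, ∀ B : 𝓑.parts, ContDiffAt ℝ 2 (hhat B) (subvec B.1 (u z)))
    (hli : IsSufficientlyNonlinear 𝓑 h Ztrain) (hpath : IsC1PathConnected Ztrain)
    (hne : Ztrain.Nonempty) (hinj : ∀ B : 𝓑.parts, Set.InjOn (h B) (projSet B.1 Ztrain)) :
    ∃ (π : Equiv.Perm (Fin d)) (hπ : RespectsPartition 𝓑 π)
      (vbar : ∀ B : 𝓑.parts, Vec B.1 → Vec (permBlock hπ B).1),
      ∀ B : 𝓑.parts, ∀ z ∈ Ztrain, subvec (permBlock hπ B).1 z = vbar B (subvec B.1 (u z)) := by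
  obtain ⟨π, hπ, hsparse⟩ := exists_perm_of_blockwise (blockOf_surjective 𝓑)
    hpath.isPreconnected hne (m := fun z => jacobianMatrix v (u z)) hr.continuousOn_jacobianMatrix
    (fun z hz => hr.det_jacobianMatrix_ne_zero hz)
    (fun z hz i i' j j' hi hj => hr.jacobianMatrix_mul_add_mul heq hh hhhat hli hz hi hj)
  obtain ⟨z₀, hz₀⟩ := hne
  have hR := respectsPartition_of_blockOf_iff hπ
  refine ⟨π, hR, fun B w => Function.invFunOn (h (permBlock hR B))
    (projSet (permBlock hR B).1 Ztrain) (hhat B w - (hhat B (subvec B.1 (u z₀)) -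
      h (permBlock hR B) (subvec (permBlock hR B).1 z₀))), fun B z hz => ?_⟩
  beta_reduce
  rw [← hr.block_sub_permBlock_eq (hπ := hR) heq hh hhhat hpath hsparse B hz₀ hz, sub_sub_cancel]
  exact ((hinj _).leftInvOn_invFunOn (Set.mem_image_of_mem _ hz)).symm

theorem corollary1 {d n : ℕ} (𝓑 : BlockPartition d)
    -- an invertible transformation of the observation space (onto its range)
    (σ : Vec (Fin n) → Vec (Fin n)) (hσ : Function.Injective σ)
    -- data-generating process
    (Ztest Ztrain : Set (Vec (Fin d))) (f : Vec (Fin d) → Vec (Fin n))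
    (P : Measure (Vec (Fin d))) (hdata : IsDataGenerating Ztest Ztrain f P)
    -- learned decoder and encoder
    (fhat : Vec (Fin d) → Vec (Fin n)) (hfhat : IsC2DiffeoOntoImage fhat Set.univ)
    (ghat : Vec (Fin n) → Vec (Fin d)) (hghat : Continuous ghat)
    -- both decoders are additive
    (fB fhatB : ∀ B : 𝓑.parts, Vec B.1 → Vec (Fin n))
    (hadd : IsAdditiveWith σ 𝓑 Ztest f fB)
    (haddhat : IsAdditiveWith σ 𝓑 Set.univ fhat fhatB)
    -- sufficient nonlinearity of the ground-truth decoder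
    (hnonlin : IsSufficientlyNonlinear 𝓑 fB Ztrain)
    -- connectedness of the training support
    (hpath : IsC1PathConnected Ztrain)
    -- injectivity of the block-specific decoders
    (hinj : ∀ B : 𝓑.parts, Set.InjOn (fB B) (projSet B.1 Ztrain))
    (hinjhat : ∀ B : 𝓑.parts, Set.InjOn (fhatB B) (projSet B.1 (latentCodes ghat f Ztrain)))
    -- exact reconstruction on the training distribution
    (hrec : SolvesReconstruction P f fhat ghat) :
    -- the permutation and the block maps exist
    (∃ (π : Equiv.Perm (Fin d)) (hπ : RespectsPartition 𝓑 π)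
        (vbar : ∀ B : 𝓑.parts, Vec B.1 → Vec (permBlock hπ B).1),
        IsDisentangledVia 𝓑 Ztest Ztrain (latentCodes ghat f Ztrain) f fhat π hπ vbar) ∧
    -- for any such choice, the decoders match on the whole Cartesian-product extension
    (∀ (π : Equiv.Perm (Fin d)) (hπ : RespectsPartition 𝓑 π)
        (vbar : ∀ B : 𝓑.parts, Vec B.1 → Vec (permBlock hπ B).1),
        IsDisentangledVia 𝓑 Ztest Ztrain (latentCodes ghat f Ztrain) f fhat π hπ vbar →
        ∀ z ∈ cartesianExt 𝓑 (latentCodes ghat f Ztrain),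
          σ (∑ B : 𝓑.parts, fhatB B (subvec B.1 z)) =
            σ (∑ B : 𝓑.parts, fB (permBlock hπ B) (vbar B (subvec B.1 z)))) ∧
    -- extrapolated observations stay in the set of possible observations
    (cartesianExt 𝓑 Ztrain ⊆ Ztest →
      fhat '' cartesianExt 𝓑 (latentCodes ghat f Ztrain) ⊆ f '' Ztest) := by
  have hrec' : ∀ z ∈ Ztrain, fhat (ghat (f z)) = f z := fun z hz =>
    fhat_ghat_f_eq hdata hfhat hghat hrec hz
  obtain ⟨u, v, hr, hu⟩ := exists_isC2Reparam hdata hfhat hrec'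
  have hvMap : ∀ z ∈ Ztrain, vMap Ztest f fhat (u z) = z := fun z hz => by
    rw [hu z hz, vMap_ghat_f_eq hdata hrec' hz]
  have hZhat : latentCodes ghat f Ztrain = u '' Ztrain := by
    rw [latentCodes, Set.image_image]
    exact Set.image_congr fun z hz => (hu z hz).symm
  have heq : ∀ z ∈ Ztrain, blockSum fhatB (u z) = blockSum fB z := by
    intro z hz
    apply hσ
    have h1 := haddhat.eq_sum (u z) (Set.mem_univ _)
    have h2 : fhat (u z) = f z := by rw [hu z hz, hrec' z hz]
    rw [h2, hadd.eq_sum z (hdata.train_subset_test hz)] at h1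
    exact h1.symm
  have hh : ∀ z ∈ Ztrain, ∀ B : 𝓑.parts, ContDiffAt ℝ 2 (fB B) (subvec B.1 z) := fun z hz B =>
    (hadd.c2_block B).contDiffAt (isOpen_projSet B.1 hdata.isOpen_test)
      (Set.mem_image_of_mem _ (hdata.train_subset_test hz))
  have hhhat : ∀ z ∈ Ztrain, ∀ B : 𝓑.parts, ContDiffAt ℝ 2 (fhatB B) (subvec B.1 (u z)) :=
    fun z _ B => (haddhat.c2_block B).contDiffAt (isOpen_projSet B.1 isOpen_univ)
      (Set.mem_image_of_mem _ (Set.mem_univ _))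
  have hne : Ztrain.Nonempty := by
    have := hdata.prob
    rw [← hdata.support_eq]
    exact Measure.nonempty_support (IsProbabilityMeasure.ne_zero P)
  rw [hZhat]
  have hexists : ∃ (π : Equiv.Perm (Fin d)) (hπ : RespectsPartition 𝓑 π)
      (vbar : ∀ B : 𝓑.parts, Vec B.1 → Vec (permBlock hπ B).1),
      IsDisentangledVia 𝓑 Ztest Ztrain (u '' Ztrain) f fhat π hπ vbar := by
    obtain ⟨π, hπ, vbar, hvbar⟩ :=
      hr.exists_block_maps heq hh hhhat hnonlin hpath hne hinj
    refine ⟨π, hπ, vbar, ⟨?_, ⟨?_, ?_, ?_⟩, ?_, ?_⟩⟩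
    · rw [Set.image_image]
      exact Set.image_congr fun z hz => by rw [hu z hz, hrec' z hz]
    · refine Set.InvOn.bijOn (f' := u) ⟨?_, hvMap⟩ ?_ (Set.mapsTo_image u Ztrain)
      · rintro _ ⟨z, hz, rfl⟩
        rw [hvMap z hz]
      · rintro _ ⟨z, hz, rfl⟩
        rwa [hvMap z hz]
    · refine isC2On_of_contDiffAt (g := v) ?_ ?_
      · rintro _ ⟨z, hz, rfl⟩
        exact hr.c2_inv z hz
      · rintro _ ⟨z, hz, rfl⟩
        rw [hvMap z hz, hr.left_inv z hz]
    · refine ⟨u, ⟨?_, hvMap⟩, isC2On_of_contDiffAt hr.c2 fun _ _ => rfl⟩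
      rintro _ ⟨z, hz, rfl⟩
      rw [hvMap z hz]
    · rintro B _ ⟨_, ⟨z, hz, rfl⟩, rfl⟩
      rw [← hvbar B z hz]
      exact Set.mem_image_of_mem _ hz
    · rintro B _ ⟨z, hz, rfl⟩
      rw [hvMap z hz, hvbar B z hz]
  have hmatch : ∀ (π : Equiv.Perm (Fin d)) (hπ : RespectsPartition 𝓑 π)
      (vbar : ∀ B : 𝓑.parts, Vec B.1 → Vec (permBlock hπ B).1),
      IsDisentangledVia 𝓑 Ztest Ztrain (u '' Ztrain) f fhat π hπ vbar →
      ∀ z ∈ cartesianExt 𝓑 (u '' Ztrain), σ (∑ B : 𝓑.parts, fhatB B (subvec B.1 z)) =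
        σ (∑ B : 𝓑.parts, fB (permBlock hπ B) (vbar B (subvec B.1 z))) := by
    intro π hπ vbar hD z hz
    have hvbar : ∀ B : 𝓑.parts, ∀ z ∈ Ztrain,
        subvec (permBlock hπ B).1 z = vbar B (subvec B.1 (u z)) := fun B z hz => by
      rw [← hD.block_eq B (u z) (Set.mem_image_of_mem u hz), hvMap z hz]
    obtain ⟨z₀, hz₀⟩ := hne
    congr 1
    rw [← sub_eq_zero, ← Finset.sum_sub_distrib]
    -- each block contributes the constant of its block functions, computed at `z₀`
    have hconst : ∀ B : 𝓑.parts,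
        fhatB B (subvec B.1 z) - fB (permBlock hπ B) (vbar B (subvec B.1 z)) =
          fhatB B (subvec B.1 (u z₀)) - fB (permBlock hπ B) (subvec (permBlock hπ B).1 z₀) := by
      intro B
      obtain ⟨_, ⟨y, hy, rfl⟩, hyz⟩ := hz B.1 B.2
      rw [← hyz, ← hvbar B y hy]
      exact hr.block_sub_permBlock_eq heq hh hhhat hpath
        (fun z hz i j hij => hr.jacobianMatrix_eq_zero hvbar hz hij) B hz₀ hy
    rw [Finset.sum_congr rfl fun B _ => hconst B, Finset.sum_sub_distrib, sub_eq_zero,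
      (permBlock_bijective hπ).sum_comp fun B : 𝓑.parts => fB B (subvec B.1 z₀)]
    exact heq z₀ hz₀
  refine ⟨hexists, hmatch, ?_⟩
  rintro hcpe _ ⟨z, hz, rfl⟩
  obtain ⟨π, hπ, vbar, hD⟩ := hexists
  have hpre : ∀ B : 𝓑.parts, ∃ y ∈ Ztrain, subvec (permBlock hπ B).1 y = vbar B (subvec B.1 z) :=
    fun B => hD.mapsTo B (hz B.1 B.2)
  choose y hy hyz using hpre
  let e := Equiv.ofBijective _ (permBlock_bijective hπ)
  -- the latent whose block `π(B)` is `v̄_{π(B)}(z_B)`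
  let w : Vec (Fin d) := glueBlocks fun B : 𝓑.parts => subvec B.1 (y (e.symm B))
  have hw : ∀ B : 𝓑.parts, subvec B.1 w = subvec B.1 (y (e.symm B)) := subvec_glueBlocks _
  have hwB : ∀ B : 𝓑.parts, subvec (permBlock hπ B).1 w = vbar B (subvec B.1 z) := fun B => by
    rw [hw, ← hyz B, show e.symm (permBlock hπ B) = B from e.symm_apply_apply B]
  have hwtest : w ∈ Ztest := hcpe fun B hB =>
    ⟨y (e.symm ⟨B, hB⟩), hy _, (hw ⟨B, hB⟩).symm⟩
  refine ⟨w, hwtest, ?_⟩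
  rw [hadd.eq_sum w hwtest, haddhat.eq_sum z (Set.mem_univ z), hmatch π hπ vbar hD z hz,
    ← (permBlock_bijective hπ).sum_comp fun B : 𝓑.parts => fB B (subvec B.1 w)]
  simp only [hwB]
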